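/- Let $V$ be a Euclidean space, $\Phi\subset V$ an irreducible reduced crystallographic root system spanning $V$, with simple system $\Delta=\{\alpha_1,\dots,\alpha_n\}$ and positive roots $\Phi^+$. Write $\alpha^\vee=2\alpha/\langle\alpha,\alpha\rangle$, let $W$ be the Weyl group (generated by the reflections $s_\alpha$, $\alpha\in\Phi$; $s_i=s_{\alpha_i}$), let $\tau_x$ be the translation by $x$, and let $W_a$ be the affine Weyl group, generated by the affine reflections $s_{\alpha,k}(x)=x-(\langle x,\alpha^\vee\rangle-k)\alpha$ with $\alpha\in\Phi$, $k\in\mathbb Z$; one has $W_a\simeq\mathbb Z\Phi\rtimes W$. Let $A_e=\{x\in V: 0<\langle x,\alpha^\vee\rangle<1\ \forall\alpha\in\Phi^+\}$. For $w\in W_a$ put $A_w=wA_e$; the Shi coefficients $k(w,\alpha)$ are the unique integers with $$A_w=\{x\in V: k(w,\alpha)<\langle x,\alpha^\vee\rangle<k(w,\alpha)+1\ \ \forall\alpha\in\Phi^+\},$$ and $\iota(w)=(k(w,\alpha))_{\alpha\in\Phi^+}\in\mathbb R^{\Phi^+}$ is the Shi vector of $w$. Two alcoves $A_w,A_{w'}$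 have the same orientation if $w'=\tau_xw$ for some $x\in\mathbb Z\Phi$. For $\theta\in\Phi^+$ write $\theta^\vee=\sum_i c_{\theta,i}\alpha_i^\vee$ and put $P_\theta=\sum_i c_{\theta,i}X_{\alpha_i}$ and $h(\theta^\vee)=\sum_i c_{\theta,i}$. A vector $\lambda\in\mathbb N^{\Phi^+}$ is admitted if $0\le\lambda_\theta\le h(\theta^\vee)-1$ for all $\theta\in\Phi^+$ and, for all $\alpha,\beta\in\Phi^+$ with $\alpha+\beta\in\Phi^+$, $$\|\alpha\|^2\lambda_\alpha+\|\beta\|^2\lambda_\beta+1\le\|\alpha+\beta\|^2(\lambda_{\alpha+\beta}+1)\le\|\alpha\|^2\lambda_\alpha+\|\beta\|^2\lambda_\beta+\|\alpha\|^2+\|\beta\|^2+\|\alpha+\beta\|^2-1,$$ where the norm in these inequalities is rescaled so that short roots have norm $1$. The Shi variety $\widehat X_{W_a}\subset\mathbb R^{\Phi^+}$ is the union over all admitted $\lambda$ of the zero loci of the ideals $\langle P_\theta+\lambda_\theta-X_\theta : \theta\in\Phi^+\rangle\subset\mathbb R[X_\theta:\theta\in\Phi^+]$; its irreducible components are taken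 in the Zariski topology. For $w\in W_a$ let $\mathsf s_w$ be the unique homomorphic section of $\mathbb Z\Phi\rtimes W\to W$ with $\mathsf s_w(s_i)=\tau_{k(w,\alpha_i)\alpha_i}s_i$ for $i=1,\dots,n$. A section $\mathsf s$, written as $\mathsf s(g)=\tau_{f(g)}g$, defines the class of the $1$-cocycle $f$ in $H^1(W,\mathbb Z\Phi)$. **Theorem.** Let $w,w'\in W_a$ be such that $\iota(w)$ and $\iota(w')$ lie in the same irreducible component of $\widehat X_{W_a}$. Then $A_w$ and $A_{w'}$ have the same orientation if and only if $\mathsf s_w$ and $\mathsf s_{w'}$ define the same class in $H^1(W,\mathbb Z\Phi)$. -/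

import Mathlib

universe u

noncomputable section

namespace ShiVariety

/-! ## The root lattice, the affine Weyl group, alcoves

Throughout, `P` is a root system in a real vector space `V`; `P.root i` is a root `α`, and
`P.coroot' i x` is the number `⟨x, α^∨⟩`. -/

section Groups

variable {ι V N : Type u} [AddCommGroup V] [Module ℝ V] [AddCommGroup N] [Module ℝ N]

/-- The root lattice `ℤΦ`. -/
abbrev rootLattice (P : RootPairing ι ℝ V N) : Submodule ℤ V := P.rootSpan ℤ

/-- A root, as an element of the root lattice. -/
abbrev latticeRoot (P : RootPairing ι ℝ V N) (i : ι) : rootLattice P := P.rootSpanMem ℤ i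

/-- The translation `τ_x` of `V`. -/
def translation (x : V) : V ≃ᵃ[ℝ] V := AffineEquiv.constVAdd ℝ V x

/-- The affine reflection `s_{α,k} : x ↦ x - (⟨x, α^∨⟩ - k) α`. -/
def affineReflection (P : RootPairing ι ℝ V N) (i : ι) (k : ℤ) : V ≃ᵃ[ℝ] V :=
  translation ((k : ℝ) • P.root i) * (P.reflection i).toAffineEquiv

theorem affineReflection_apply (P : RootPairing ι ℝ V N) (i : ι) (k : ℤ) (x : V) :
    affineReflection P i k x = x - (P.coroot' i x - k) • P.root i := by
  simp only [affineReflection, translation, AffineEquiv.mul_def, AffineEquiv.trans_apply,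
    LinearEquiv.coe_toAffineEquiv, AffineEquiv.constVAdd_apply, P.reflection_apply, vadd_eq_add]
  module

/-- The affine Weyl group `W_a`, generated by all the affine reflections `s_{α,k}`. -/
def affineWeylGroup (P : RootPairing ι ℝ V N) : Subgroup (V ≃ᵃ[ℝ] V) :=
  Subgroup.closure (Set.range fun p : ι × ℤ => affineReflection P p.1 p.2)

/-- The set of positive roots `Φ⁺` with respect to the simple system `b`. -/
abbrev PosRoot {P : RootPairing ι ℝ V N} (b : P.Base) : Type u := {i : ι // b.IsPos i}

/-- A simple root, as a positive root. -/
def simplePos {P : RootPairing ι ℝ V N} (b : P.Base) (i : b.support) : PosRoot b :=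
  ⟨i, RootPairing.Base.isPos_of_mem_support i.2⟩

/-- The strip `H_{α,k}^1 = {x | k < ⟨x, α^∨⟩ < k + 1}`. -/
def strip (P : RootPairing ι ℝ V N) (i : ι) (k : ℤ) : Set V :=
  {x | (k : ℝ) < P.coroot' i x ∧ P.coroot' i x < k + 1}

/-- The fundamental alcove `A_e`. -/
def fundAlcove {P : RootPairing ι ℝ V N} (b : P.Base) : Set V :=
  ⋂ α : PosRoot b, strip P α.1 0

/-- The alcove `A_w = w A_e`. -/
def alcove {P : RootPairing ι ℝ V N} (b : P.Base) (w : affineWeylGroup P) : Set V :=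
  (w : V ≃ᵃ[ℝ] V) '' fundAlcove b

/-- The alcoves `A_w` and `A_{w'}` have the same orientation: `w' = τ_x w` for some `x ∈ ℤΦ`. -/
def SameOrientation {P : RootPairing ι ℝ V N} (w w' : affineWeylGroup P) : Prop :=
  ∃ x : rootLattice P, (w' : V ≃ᵃ[ℝ] V) = translation (x : V) * (w : V ≃ᵃ[ℝ] V)

/-! ### Existence and uniqueness of the Shi coefficients -/

theorem coroot'_affine (P : RootPairing ι ℝ V N) [P.IsCrystallographic]
    (w : V ≃ᵃ[ℝ] V) (hw : w ∈ affineWeylGroup P) :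
    ∀ i : ι, ∃ (j : ι) (m : ℤ), ∀ x, P.coroot' i (w x) = P.coroot' j x + m := by
  have gen : ∀ (j : ι) (k : ℤ) (i : ι), ∃ (l : ι) (m : ℤ), ∀ x,
      P.coroot' i (affineReflection P j k x) = P.coroot' l x + m := by
    intro j k i
    obtain ⟨z, hz⟩ := P.exists_value (S := ℤ) j i
    refine ⟨P.reflectionPerm j i, k * z, fun x => ?_⟩
    rw [← P.coroot'_reflection, affineReflection_apply, P.reflection_apply]
    simp only [map_sub, map_smul, P.root_coroot'_eq_pairing, smul_eq_mul]
    rw [← hz]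
    push_cast
    simp
    ring
  have inv : ∀ (j : ι) (k : ℤ), (affineReflection P j k)⁻¹ = affineReflection P j k := by
    intro j k
    rw [inv_eq_iff_mul_eq_one]
    ext x
    simp only [AffineEquiv.mul_def, AffineEquiv.trans_apply, affineReflection_apply, map_sub,
      map_smul, P.root_coroot'_eq_pairing, P.pairing_same, smul_eq_mul]
    change _ = x
    module
  refine Subgroup.closure_induction'' (p := fun w _ => ∀ i : ι, ∃ (j : ι) (m : ℤ), ∀ x,
    P.coroot' i (w x) = P.coroot' j x + m) ?_ ?_ ?_ ?_ hw
  · rintro _ ⟨p, rfl⟩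
    exact gen p.1 p.2
  · rintro _ ⟨p, rfl⟩
    simp only [inv]
    exact gen p.1 p.2
  · intro i
    exact ⟨i, 0, fun x => by simp⟩
  · intro v w _ _ hv hw i
    obtain ⟨j, m, h⟩ := hv i
    obtain ⟨l, n, h'⟩ := hw j
    refine ⟨l, n + m, fun x => ?_⟩
    rw [AffineEquiv.mul_def, AffineEquiv.trans_apply, h, h']
    push_cast
    ring


theorem coroot'_neg (P : RootPairing ι ℝ V N) (i : ι) (x : V) :
    P.coroot' (P.reflectionPerm i i) x = -P.coroot' i x := by
  rw [← P.coroot'_reflection, P.reflection_apply]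
  simp only [map_sub, map_smul, P.root_coroot'_eq_pairing, P.pairing_same, smul_eq_mul]
  ring

theorem pos_or_neg {P : RootPairing ι ℝ V N} (b : P.Base) (i : ι) :
    b.IsPos i ∨ b.IsPos (P.reflectionPerm i i) :=
  RootPairing.Base.IsPos.or_neg b i

theorem exists_coroot'_simple {P : RootPairing ι ℝ V N} [P.IsRootSystem] (b : P.Base)
    (c : b.support → ℝ) : ∃ y : V, ∀ i : b.support, P.coroot' i y = c i := by
  refine ⟨P.toPerfPair.symm (b.toCoweightBasis.constr ℝ c), fun i => ?_⟩
  change P.toLinearMap (P.toPerfPair.symm _) (P.coroot i) = _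
  rw [← b.toCoweightBasis_apply i]
  change P.toPerfPair (P.toPerfPair.symm _) _ = _
  rw [LinearEquiv.apply_symm_apply, Module.Basis.constr_basis]

theorem two_mul_rootForm [Fintype ι] (P : RootPairing ι ℝ V N) [P.IsRootSystem] (i : ι) (x : V) :
    2 * P.RootForm x (P.root i) = P.coroot' i x * P.RootForm (P.root i) (P.root i) := by
  have h : P.RootForm (P.reflection i x) (P.reflection i (P.root i)) = P.RootForm x (P.root i) :=
    P.rootForm_reflection_reflection_apply i x (P.root i)
  rw [P.reflection_apply_self, P.reflection_apply] at h
  simp only [map_sub, map_smul, map_neg, LinearMap.sub_apply, LinearMap.smul_apply,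
    smul_eq_mul] at h
  linarith

theorem fundAlcove_nonempty [Finite ι] {P : RootPairing ι ℝ V N} [P.IsRootSystem]
    [P.IsCrystallographic] (b : P.Base) : (fundAlcove b).Nonempty := by
  have := Fintype.ofFinite ι
  obtain ⟨y, hy⟩ := exists_coroot'_simple b (fun _ => 1)
  have hB : ∀ i, 0 < P.RootForm (P.root i) (P.root i) := fun i => by
    rw [P.rootForm_root_self]
    have h0 : (0 : ℝ) ≤ ∑ j, P.pairing i j * P.pairing i j :=
      Finset.sum_nonneg fun j _ => mul_self_nonneg _
    refine lt_of_lt_of_le (b := P.pairing i i * P.pairing i i) (by simp) ?_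
    exact Finset.single_le_sum (f := fun j => P.pairing i j * P.pairing i j)
      (fun j _ => mul_self_nonneg _) (Finset.mem_univ i)
  have hpos : ∀ i, b.IsPos i → 0 < P.coroot' i y := by
    intro i hi
    obtain ⟨f, -, hf, hfi⟩ := b.exists_root_eq_sum_int i
    have hht := RootPairing.Base.height_eq_sum hfi
    have hf0 : ∀ j, 0 ≤ f j := by
      rcases hf with h | h
      · exact h.le
      · have : b.height i ≤ 0 := by
          rw [hht]; exact Finset.sum_nonpos fun j _ => h.le j
        exact absurd hi (not_lt.mpr this)
    have hex : ∃ j ∈ b.support, 0 < f j := by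
      by_contra! hc
      have : b.height i ≤ 0 := by rw [hht]; exact Finset.sum_nonpos hc
      exact absurd hi (not_lt.mpr this)
    have key : 0 < P.RootForm y (P.root i) := by
      rw [hfi, map_sum]
      have hsimple : ∀ j ∈ b.support, 0 < P.RootForm y (P.root j) := fun j hj => by
        have := two_mul_rootForm P j y
        rw [hy ⟨j, hj⟩] at this
        have := hB j
        linarith
      obtain ⟨j, hj, hfj⟩ := hex
      refine Finset.sum_pos' (fun l hl => ?_) ⟨j, hj, ?_⟩
      · rw [map_zsmul, zsmul_eq_mul]
        exact mul_nonneg (by exact_mod_cast hf0 l) (hsimple l hl).le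
      · rw [map_zsmul, zsmul_eq_mul]
        exact mul_pos (by exact_mod_cast hfj) (hsimple j hj)
    have := two_mul_rootForm P i y
    exact pos_of_mul_pos_left (b := P.RootForm (P.root i) (P.root i)) (by linarith) (hB i).le
  obtain ⟨M, hM⟩ := (Set.finite_range fun i => P.coroot' i y).bddAbove
  have hM' : ∀ i, P.coroot' i y ≤ M := fun i => hM ⟨i, rfl⟩
  refine ⟨(|M| + 1)⁻¹ • y, Set.mem_iInter.mpr fun α => ?_⟩
  have h1 : 0 < |M| + 1 := by positivity
  simp only [strip, Set.mem_ofPred_eq, map_smul, smul_eq_mul, Int.cast_zero, zero_add]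
  refine ⟨mul_pos (inv_pos.mpr h1) (hpos _ α.2), ?_⟩
  rw [inv_mul_lt_iff₀ h1]
  have := hM' α.1
  have := le_abs_self M
  linarith

theorem existsUnique_shi [Finite ι] {P : RootPairing ι ℝ V N} [P.IsRootSystem]
    [P.IsCrystallographic] (b : P.Base) (w : affineWeylGroup P) :
    ∃! k : PosRoot b → ℤ, alcove b w = ⋂ α : PosRoot b, strip P α.1 (k α) := by
  have uniq : ∀ {i : ι} {k l : ℤ} {x : V}, x ∈ strip P i k → x ∈ strip P i l → k = l := by
    intro i k l x h h'
    have h1 : (k : ℝ) < l + 1 := h.1.trans h'.2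
    have h2 : (l : ℝ) < k + 1 := h'.1.trans h.2
    norm_cast at h1 h2
    lia
  obtain ⟨x₀, hx₀⟩ := fundAlcove_nonempty b
  -- every affine functional attached to a root takes the alcove into a single unit interval
  have hA : ∀ i : ι, ∃ k : ℤ, ∀ x ∈ fundAlcove b, x ∈ strip P i k := by
    intro i
    rcases pos_or_neg b i with hi | hi
    · exact ⟨0, fun x hx => Set.mem_iInter.mp hx ⟨i, hi⟩⟩
    · refine ⟨-1, fun x hx => ?_⟩
      have := Set.mem_iInter.mp hx ⟨_, hi⟩
      simp only [strip, Set.mem_ofPred_eq, coroot'_neg] at this ⊢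
      push_cast at this ⊢
      constructor <;> linarith [this.1, this.2]
  have hw : ∀ i : ι, ∃ k : ℤ, ∀ x ∈ fundAlcove b, (w : V ≃ᵃ[ℝ] V) x ∈ strip P i k := by
    intro i
    obtain ⟨j, m, h⟩ := coroot'_affine P w w.2 i
    obtain ⟨k, hk⟩ := hA j
    refine ⟨k + m, fun x hx => ?_⟩
    have := hk x hx
    simp only [strip, Set.mem_ofPred_eq, h] at this ⊢
    push_cast
    constructor <;> linarith [this.1, this.2]
  choose k hk using hw
  have hback : ∀ y, (∀ α : PosRoot b, y ∈ strip P α.1 (k α.1)) →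
      ((w : V ≃ᵃ[ℝ] V)⁻¹ : V ≃ᵃ[ℝ] V) y ∈ fundAlcove b := by
    intro y hy
    refine Set.mem_iInter.mpr fun α => ?_
    obtain ⟨j, m, h⟩ := coroot'_affine P _ (inv_mem w.2) α.1
    have h0 := h ((w : V ≃ᵃ[ℝ] V) x₀)
    rw [show ((w : V ≃ᵃ[ℝ] V)⁻¹ : V ≃ᵃ[ℝ] V) ((w : V ≃ᵃ[ℝ] V) x₀) = x₀ from
      AffineEquiv.symm_apply_apply _ _] at h0
    have hs := Set.mem_iInter.mp hx₀ α
    simp only [strip, Set.mem_ofPred_eq, h, h0] at hs ⊢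
    push_cast at hs ⊢
    rcases pos_or_neg b j with hj | hj
    · have e1 := hy ⟨j, hj⟩
      have e2 := hk j x₀ hx₀
      have e3 : (k j : ℤ) = -m := uniq e2 (by
        simp only [strip, Set.mem_ofPred_eq]; push_cast; constructor <;> linarith [hs.1, hs.2])
      simp only [strip, Set.mem_ofPred_eq, e3] at e1
      push_cast at e1
      constructor <;> linarith [e1.1, e1.2]
    · have e1 := hy ⟨_, hj⟩
      have e2 := hk (P.reflectionPerm j j) x₀ hx₀
      have e3 : k (P.reflectionPerm j j) = m - 1 := uniq e2 (by
        simp only [strip, Set.mem_ofPred_eq, coroot'_neg]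
        push_cast; constructor <;> linarith [hs.1, hs.2])
      simp only [strip, Set.mem_ofPred_eq, coroot'_neg, e3] at e1
      push_cast at e1
      constructor <;> linarith [e1.1, e1.2]
  refine ⟨fun α => k α.1, ?_, fun l hl => funext fun α => ?_⟩
  · ext y
    refine ⟨?_, fun hy => ⟨_, hback y (Set.mem_iInter.mp hy), AffineEquiv.apply_symm_apply _ _⟩⟩
    rintro ⟨x, hx, rfl⟩
    exact Set.mem_iInter.mpr fun α => hk α.1 x hx
  · have h1 : (w : V ≃ᵃ[ℝ] V) x₀ ∈ alcove b w := ⟨x₀, hx₀, rfl⟩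
    rw [hl] at h1
    exact uniq (Set.mem_iInter.mp h1 α) (hk α.1 x₀ hx₀)

/-- The Shi coefficients `k(w, α)`, `α ∈ Φ⁺`: the unique integers with
`A_w = ⋂_{α ∈ Φ⁺} H_{α, k(w,α)}^1`. -/
def shiCoeff [Finite ι] {P : RootPairing ι ℝ V N} [P.IsRootSystem] [P.IsCrystallographic]
    (b : P.Base) (w : affineWeylGroup P) : PosRoot b → ℤ :=
  (existsUnique_shi b w).choose

theorem alcove_eq [Finite ι] {P : RootPairing ι ℝ V N} [P.IsRootSystem] [P.IsCrystallographic]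
    (b : P.Base) (w : affineWeylGroup P) :
    alcove b w = ⋂ α : PosRoot b, strip P α.1 (shiCoeff b w α) :=
  (existsUnique_shi b w).choose_spec.1

/-- The Shi vector `ι(w) = (k(w, α))_{α ∈ Φ⁺}`. -/
def shiVector [Finite ι] {P : RootPairing ι ℝ V N} [P.IsRootSystem] [P.IsCrystallographic]
    (b : P.Base) (w : affineWeylGroup P) : PosRoot b → ℝ :=
  fun α => (shiCoeff b w α : ℝ)

/-! ## Sections of `ℤΦ ⋊ W → W` and the group `H¹(W, ℤΦ)` -/

theorem weyl_smul_mem (P : RootPairing ι ℝ V N) (g : P.weylGroup) {x : V}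
    (hx : x ∈ rootLattice P) : g • x ∈ rootLattice P := by
  induction hx using Submodule.span_induction with
  | mem x h =>
    obtain ⟨i, rfl⟩ := h
    rw [P.weylGroup_apply_root]
    exact Submodule.subset_span ⟨_, rfl⟩
  | zero => rw [smul_zero]; exact zero_mem _
  | add x y _ _ hx hy => rw [smul_add]; exact add_mem hx hy
  | smul a x _ hx =>
    rw [show g • a • x = a • g • x from map_zsmul (DistribSMul.toAddMonoidHom V g) a x]
    exact Submodule.smul_mem _ _ hx

/-- The natural action of the Weyl group on the root lattice. -/
instance latticeAction (P : RootPairing ι ℝ V N) :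
    DistribMulAction P.weylGroup (rootLattice P) where
  smul g x := ⟨g • (x : V), weyl_smul_mem P g x.2⟩
  one_smul x := Subtype.ext (one_smul _ (x : V))
  mul_smul g h x := Subtype.ext (mul_smul g h (x : V))
  smul_zero g := Subtype.ext (smul_zero g)
  smul_add g x y := Subtype.ext (smul_add g (x : V) (y : V))

theorem coe_weyl_smul (P : RootPairing ι ℝ V N) (g : P.weylGroup) (x : rootLattice P) :
    ((g • x : rootLattice P) : V) = g • (x : V) := rfl

/-- The action of `W` on `ℤΦ` as a homomorphism `W → Aut(ℤΦ)`, with `ℤΦ` written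
multiplicatively. -/
def latticeAut (P : RootPairing ι ℝ V N) :
    P.weylGroup →* MulAut (Multiplicative (rootLattice P)) :=
  (MulAutMultiplicative (rootLattice P)).symm.toMonoidHom.comp
    (DistribMulAction.toAddAut P.weylGroup (rootLattice P))

theorem latticeAut_apply (P : RootPairing ι ℝ V N) (g : P.weylGroup)
    (x : Multiplicative (rootLattice P)) :
    latticeAut P g x = Multiplicative.ofAdd (g • x.toAdd) := rfl

/-- The extension `1 → ℤΦ → ℤΦ ⋊ W → W → 1`. -/
abbrev extension (P : RootPairing ι ℝ V N) :
    GroupExtension (Multiplicative (rootLattice P))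
      (Multiplicative (rootLattice P) ⋊[latticeAut P] P.weylGroup) P.weylGroup :=
  SemidirectProduct.toGroupExtension (latticeAut P)

/-- The element `τ_x g` of `ℤΦ ⋊ W`. -/
def semi (P : RootPairing ι ℝ V N) (x : rootLattice P) (g : P.weylGroup) :
    Multiplicative (rootLattice P) ⋊[latticeAut P] P.weylGroup :=
  SemidirectProduct.inl (Multiplicative.ofAdd x) * SemidirectProduct.inr g

/-- The reflection `s_α ∈ W`. -/
abbrev weylReflection (P : RootPairing ι ℝ V N) (i : ι) : P.weylGroup :=
  RootPairing.weylGroup.ofIdx P i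

theorem weylReflection_reflectionPerm (P : RootPairing ι ℝ V N) (i j : ι) :
    weylReflection P (P.reflectionPerm j i) =
      weylReflection P j * weylReflection P i * weylReflection P j := by
  refine Subtype.ext (RootPairing.Equiv.weightHom_injective P (LinearEquiv.ext fun x => ?_))
  have := LinearEquiv.congr_fun (P.reflection_reflectionPerm (i := i) (j := j)) x
  exact this

theorem existsUnique_section [Finite ι] {P : RootPairing ι ℝ V N} [P.IsRootSystem]
    [P.IsCrystallographic] [P.IsReduced] (b : P.Base) (k : b.support → ℤ) :
    ∃! s : (extension P).Splitting, ∀ i : b.support,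
      s (weylReflection P i) = semi P (k i • latticeRoot P i) (weylReflection P i) := by
  obtain ⟨p, hp⟩ := exists_coroot'_simple b fun i => (k i : ℝ)
  have hint : ∀ i : ι, ∃ m : ℤ, P.coroot' i p = m := by
    intro i
    have h : P.coroot i ∈ Submodule.span ℤ (P.coroot '' b.support) := b.coroot_mem_span_int i
    change ∃ m : ℤ, P.toLinearMap p (P.coroot i) = m
    generalize P.coroot i = c at h
    induction h using Submodule.span_induction with
    | mem x h =>
      obtain ⟨j, hj, rfl⟩ := h
      exact ⟨k ⟨j, hj⟩, hp ⟨j, hj⟩⟩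
    | zero => exact ⟨0, by simp⟩
    | add x y _ _ hx hy =>
      obtain ⟨m, hm⟩ := hx
      obtain ⟨n, hn⟩ := hy
      exact ⟨m + n, by rw [map_add, hm, hn]; push_cast; ring⟩
    | smul a x _ hx =>
      obtain ⟨m, hm⟩ := hx
      exact ⟨a * m, by rw [map_zsmul, hm, zsmul_eq_mul]; push_cast; ring⟩
  have hmem : ∀ g : P.weylGroup, p - g • p ∈ rootLattice P := by
    rintro ⟨g, hg⟩
    induction hg using RootPairing.weylGroup.induction with
    | mem i =>
      obtain ⟨m, hm⟩ := hint i
      have : p - weylReflection P i • p = m • P.root i := by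
        change p - P.reflection i p = _
        rw [P.reflection_apply, hm, Int.cast_smul_eq_zsmul]
        abel
      change p - weylReflection P i • p ∈ _
      rw [this]
      exact Submodule.smul_mem _ _ (Submodule.subset_span ⟨i, rfl⟩)
    | one =>
      change p - (1 : P.weylGroup) • p ∈ _
      rw [one_smul, sub_self]
      exact zero_mem _
    | mul g h hg hh ihg ihh =>
      have : p - ((⟨g, hg⟩ * ⟨h, hh⟩ : P.weylGroup) • p) =
          (p - (⟨g, hg⟩ : P.weylGroup) • p) +
            (⟨g, hg⟩ : P.weylGroup) • (p - (⟨h, hh⟩ : P.weylGroup) • p) := by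
        rw [mul_smul, smul_sub]
        abel
      change p - ((⟨g, hg⟩ * ⟨h, hh⟩ : P.weylGroup) • p) ∈ _
      rw [this]
      exact add_mem ihg (weyl_smul_mem P _ ihh)
  let f : P.weylGroup → rootLattice P := fun g => ⟨p - g • p, hmem g⟩
  have hf : ∀ g h, f (g * h) = f g + g • f h := by
    intro g h
    refine Subtype.ext ?_
    change p - (g * h) • p = (p - g • p) + g • (p - h • p)
    rw [mul_smul, smul_sub]
    abel
  let s : P.weylGroup →* Multiplicative (rootLattice P) ⋊[latticeAut P] P.weylGroup :=
    MonoidHom.mk' (fun g => ⟨Multiplicative.ofAdd (f g), g⟩) (by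
      intro g h
      refine SemidirectProduct.ext ?_ rfl
      change Multiplicative.ofAdd (f (g * h)) = Multiplicative.ofAdd (f g + g • f h)
      rw [hf])
  have hs : ∀ i : b.support,
      s (weylReflection P i) = semi P (k i • latticeRoot P i) (weylReflection P i) := by
    intro i
    refine SemidirectProduct.ext ?_ ?_
    · simp only [semi, SemidirectProduct.mul_left, SemidirectProduct.left_inl,
        SemidirectProduct.left_inr, map_one, mul_one]
      refine congrArg Multiplicative.ofAdd (Subtype.ext ?_)
      change p - P.reflection i p = k i • P.root i
      rw [P.reflection_apply, hp, Int.cast_smul_eq_zsmul]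
      abel
    · simp [semi, s]
  refine ⟨⟨s, fun g => rfl⟩, hs, fun t ht => ?_⟩
  · have huniq : ∀ g : P.weylGroup, t g = s g := by
      have hsimple : ∀ i ∈ b.support, t (weylReflection P i) = s (weylReflection P i) := by
        intro i hi
        rw [ht ⟨i, hi⟩, hs ⟨i, hi⟩]
      have hrefl : ∀ i, t (weylReflection P i) = s (weylReflection P i) := by
        intro i
        refine b.induction_reflect i (p := fun i => t (weylReflection P i) =
          s (weylReflection P i)) ?_ hsimple ?_
        · intro i h
          rw [weylReflection_reflectionPerm]
          simp only [map_mul, h]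
        · intro i j h hj
          rw [weylReflection_reflectionPerm]
          simp only [map_mul, h, hsimple j hj]
      rintro ⟨g, hg⟩
      induction hg using RootPairing.weylGroup.induction with
      | mem i => exact hrefl i
      | one =>
        change t 1 = s 1
        rw [map_one, map_one]
      | mul g h hg hh ihg ihh =>
        change t (⟨g, hg⟩ * ⟨h, hh⟩) = s (⟨g, hg⟩ * ⟨h, hh⟩)
        rw [map_mul, map_mul, ihg, ihh]
    exact DFunLike.ext _ _ huniq

/-- The section `s_w` of `ℤΦ ⋊ W → W`: the unique one with `s_w(s_i) = τ_{k(w,α_i) α_i} s_i` for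
all simple roots `α_i`. -/
def shiSection [Finite ι] {P : RootPairing ι ℝ V N} [P.IsRootSystem] [P.IsCrystallographic]
    [P.IsReduced] (b : P.Base) (w : affineWeylGroup P) : (extension P).Splitting :=
  (existsUnique_section b fun i => shiCoeff b w (simplePos b i)).choose

theorem shiSection_apply [Finite ι] {P : RootPairing ι ℝ V N} [P.IsRootSystem]
    [P.IsCrystallographic] [P.IsReduced] (b : P.Base) (w : affineWeylGroup P) (i : b.support) :
    shiSection b w (weylReflection P i) =
      semi P (shiCoeff b w (simplePos b i) • latticeRoot P i) (weylReflection P i) :=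
  (existsUnique_section b fun i => shiCoeff b w (simplePos b i)).choose_spec.1 i

instance latticeAction_smulComm (P : RootPairing ι ℝ V N) :
    SMulCommClass P.weylGroup (ULift.{u} ℤ) (rootLattice P) where
  smul_comm g a x := map_zsmul (DistribSMul.toAddMonoidHom (rootLattice P) g) a.down x

/-- `ℤΦ` as a representation of `W` over `ℤ` (lifted to the universe in which `W` lives). -/
abbrev latticeRep (P : RootPairing ι ℝ V N) : Rep.{u} (ULift.{u} ℤ) P.weylGroup :=
  Rep.of (Representation.ofDistribMulAction (ULift.{u} ℤ) P.weylGroup (rootLattice P))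

/-- The 1-cocycle `f : W → ℤΦ` of a section `s`, given by `s(g) = τ_{f(g)} g`. -/
def sectionCocycle (P : RootPairing ι ℝ V N) (s : (extension P).Splitting) :
    groupCohomology.cocycles₁ (latticeRep P) :=
  ⟨fun g => ((s g).left.toAdd : rootLattice P), by
    rw [groupCohomology.mem_cocycles₁_iff]
    intro g h
    have hr : (s g).right = g := s.rightHom_splitting g
    have hm : (s (g * h)).left = (s g).left * latticeAut P (s g).right (s h).left := by
      rw [map_mul, SemidirectProduct.mul_left]
    rw [hr, latticeAut_apply] at hm
    rw [hm, toAdd_mul, toAdd_ofAdd, add_comm]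
    rfl⟩

/-- The class in `H¹(W, ℤΦ)` of a section of `ℤΦ ⋊ W → W`. -/
def sectionClass (P : RootPairing ι ℝ V N) (s : (extension P).Splitting) :
    groupCohomology.H1 (latticeRep P) :=
  groupCohomology.H1π (latticeRep P) (sectionCocycle P s)

end Groups

/-! ## The Shi variety -/

section Variety

/-- The Zariski topology on the affine space `ℝ^σ`. -/
abbrev zariskiTopology (σ : Type*) : TopologicalSpace (σ → ℝ) :=
  TopologicalSpace.ofClosed
    (Set.range fun I : Ideal (MvPolynomial σ ℝ) => MvPolynomial.zeroLocus ℝ I)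
    ⟨⊤, MvPolynomial.zeroLocus_top⟩
    (by
      intro A hA
      have hA' : ∀ Y : Set (σ → ℝ), ∃ I : Ideal (MvPolynomial σ ℝ), Y ∈ A →
          MvPolynomial.zeroLocus ℝ I = Y := fun Y => by
        by_cases hY : Y ∈ A
        · obtain ⟨I, hI⟩ := hA hY
          exact ⟨I, fun _ => hI⟩
        · exact ⟨⊤, fun h => absurd h hY⟩
      choose I hI using hA'
      refine ⟨⨆ Y ∈ A, I Y, Set.Subset.antisymm ?_ ?_⟩
      · intro x hx Y hY
        rw [← hI Y hY]
        exact fun p hp => hx p (le_iSup₂_of_le (f := fun Y (_ : Y ∈ A) => I Y) Y hY le_rfl hp)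
      · intro x hx
        have h : ⨆ Y ∈ A, I Y ≤ MvPolynomial.vanishingIdeal ℝ {x} := by
          refine iSup₂_le fun Y hY p hp => ?_
          have h1 : x ∈ MvPolynomial.zeroLocus ℝ (I Y) := by
            rw [hI Y hY]
            exact hx Y hY
          exact (MvPolynomial.mem_vanishingIdeal_singleton_iff x p).mpr (h1 p hp)
        exact fun p hp => (MvPolynomial.mem_vanishingIdeal_singleton_iff x p).mp (h hp))
    (by
      rintro _ ⟨I, rfl⟩ _ ⟨J, rfl⟩
      refine ⟨I * J, Set.Subset.antisymm ?_ ?_⟩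
      · intro x hx
        by_contra! hc
        simp only [Set.mem_union, not_or, MvPolynomial.mem_zeroLocus_iff, not_forall] at hc
        obtain ⟨⟨p, hp, hp0⟩, q, hq, hq0⟩ := hc
        have := hx (p * q) (Ideal.mul_mem_mul hp hq)
        rw [map_mul] at this
        exact (mul_ne_zero hp0 hq0) this
      · rintro x (hx | hx)
        · exact MvPolynomial.zeroLocus_anti_mono (I := I * J) (J := I) Ideal.mul_le_left hx
        · exact MvPolynomial.zeroLocus_anti_mono (I := I * J) (J := J) Ideal.mul_le_right hx)

/-- `Z` is an irreducible component of `Y ⊆ ℝ^σ` in the Zariski topology: a maximal irreducible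
subset of `Y`. -/
def IsIrredComponent {σ : Type*} (Y Z : Set (σ → ℝ)) : Prop :=
  Maximal (fun T => T ⊆ Y ∧ @IsIrreducible _ (zariskiTopology σ) T) Z

variable {ι V N : Type u} [NormedAddCommGroup V] [InnerProductSpace ℝ V]
  [AddCommGroup N] [Module ℝ N] {P : RootPairing ι ℝ V N}

/-- The coefficient of the simple coroot `α_i^∨` in `θ^∨`. -/
def corootCoeff (b : P.Base) (θ : PosRoot b) (i : b.support) : ℤ :=
  b.flip.toWeightBasisInt.repr (P.flip.rootSpanMem ℤ θ.1) i

/-- The height `h(θ^∨)` of `θ^∨`. -/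
def corootHeight (b : P.Base) (θ : PosRoot b) : ℤ :=
  ∑ i : b.support, corootCoeff b θ i

/-- The linear polynomial `P_θ` in the variables `X_{α_i}` with
`θ^∨ = P_θ(α_1^∨, …, α_n^∨)`. -/
def linPoly (b : P.Base) (θ : PosRoot b) : MvPolynomial (PosRoot b) ℝ :=
  ∑ i : b.support, MvPolynomial.C (corootCoeff b θ i : ℝ) * MvPolynomial.X (simplePos b i)

/-- The affine variety `X[λ]`: the zero locus of the ideal generated by the polynomials
`P_α + λ_α - X_α`. -/
def component (b : P.Base) (l : PosRoot b → ℕ) : Set (PosRoot b → ℝ) :=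
  MvPolynomial.zeroLocus ℝ (Ideal.span (Set.range fun α : PosRoot b =>
    linPoly b α + MvPolynomial.C (l α : ℝ) - MvPolynomial.X α))

/-- `λ` is admissible: `λ_α ∈ {0, …, h(α^∨) - 1}` for all positive roots `α`. -/
def IsAdmissible (b : P.Base) (l : PosRoot b → ℕ) : Prop :=
  ∀ α, (l α : ℤ) ≤ corootHeight b α - 1

/-- The squared length of a root, the inner product being rescaled so that short roots have
length 1. -/
def sqLength (P : RootPairing ι ℝ V N) (i : ι) : ℝ :=
  ‖P.root i‖ ^ 2 / ⨅ j, ‖P.root j‖ ^ 2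

/-- Shi's system of inequalities. -/
def ShiSystem (b : P.Base) (k : PosRoot b → ℤ) : Prop :=
  ∀ α β γ : PosRoot b, P.root γ = P.root α + P.root β →
    sqLength P α * k α + sqLength P β * k β + 1 ≤ sqLength P γ * (k γ + 1) ∧
    sqLength P γ * (k γ + 1) ≤ sqLength P α * k α + sqLength P β * k β
      + sqLength P α + sqLength P β + sqLength P γ - 1

/-- `λ` is admitted: it is admissible and satisfies Shi's system of inequalities. -/
def IsAdmitted (b : P.Base) (l : PosRoot b → ℕ) : Prop :=
  IsAdmissible b l ∧ ShiSystem b fun α => (l α : ℤ)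

/-- The Shi variety: the union of the `X[λ]` over all admitted `λ`. -/
def shiVariety (b : P.Base) : Set (PosRoot b → ℝ) :=
  ⋃ (l : PosRoot b → ℕ) (_ : IsAdmitted b l), component b l

/-- The Shi vectors of `w` and `w'` lie in the same irreducible component of the Shi variety. -/
def SameComponent [Finite ι] [P.IsRootSystem] [P.IsCrystallographic] (b : P.Base)
    (w w' : affineWeylGroup P) : Prop :=
  ∃ Z, IsIrredComponent (shiVariety b) Z ∧ shiVector b w ∈ Z ∧ shiVector b w' ∈ Z

end Variety

end ShiVariety

end

noncomputable section

namespace ShiVariety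

/-! ### Words in the simple reflections and the exchange property. -/

section Weyl

variable {ι V N : Type u} [AddCommGroup V] [Module ℝ V] [AddCommGroup N] [Module ℝ N]
  {P : RootPairing ι ℝ V N}

/-! Everything reduces to how Shi coefficients change under a translation: passing from `w` to `τ_x
w` adds `⟨x, α^∨⟩` to `k(w, α)` (`shiCoeff_translate`).

On the cohomological side, the coboundary of `x` takes the value `s_i x - x = -⟨x, α_i^∨⟩ α_i` at
`s_i`. A cocycle is determined by its values on simple reflections, so the two classes agree exactly
when some `x` in `ℤΦ` satisfies `k(w', α_i) = k(w, α_i) + ⟨x, α_i^∨⟩` for every simple root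
(`sectionClass_eq_iff`). This is the condition for `w'` and `τ_x w` to have the same Shi
coefficients at the simple roots, so same orientation implies same class.

The converse needs the common component. An irreducible set inside a finite union of closed sets
lies in one of them, so both Shi vectors lie in a single `X[λ]`. There the coordinate at `θ` is an
affine function of the simple coordinates, whose linear part expresses `θ^∨` in simple coroots. The
constants `λ_θ` cancel in the difference, so agreement at the simple roots propagates to all
positive roots, and `w'` and `τ_x w` have the same alcove.

It remains that the affine Weyl group acts freely on alcoves (`eq_one_of_alcove_eq`). If `x ↦ g x +
t` preserves the fundamental alcove, then `t` pairs with positive coroots to `0` or `1`. The root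
lattice has no nonzero minuscule vector, so `t = 0`; then `g` preserves positivity of roots and is
trivial by the exchange property. -/

theorem weylReflection_mul_self (i : ι) : weylReflection P i * weylReflection P i = 1 := by
  refine Subtype.ext ?_
  change RootPairing.Equiv.reflection P i * RootPairing.Equiv.reflection P i = 1
  rw [mul_eq_one_iff_inv_eq, RootPairing.Equiv.reflection_inv P i]

theorem weylReflection_weylGroupToPerm (g : P.weylGroup) (i : ι) :
    weylReflection P (P.weylGroupToPerm g i) = g * weylReflection P i * g⁻¹ := by
  obtain ⟨g, hg⟩ := g
  induction hg using RootPairing.weylGroup.induction generalizing i with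
  | mem j =>
    change weylReflection P (P.reflectionPerm j i) =
      weylReflection P j * weylReflection P i * (weylReflection P j)⁻¹
    rw [weylReflection_reflectionPerm, inv_eq_of_mul_eq_one_left (weylReflection_mul_self j)]
  | one =>
    change weylReflection P (P.weylGroupToPerm 1 i) = 1 * weylReflection P i * (1 : P.weylGroup)⁻¹
    simp
  | mul g h hg hh ihg ihh =>
    change weylReflection P (P.weylGroupToPerm (⟨g, hg⟩ * ⟨h, hh⟩) i) =
      (⟨g, hg⟩ * ⟨h, hh⟩) * weylReflection P i * (⟨g, hg⟩ * ⟨h, hh⟩ : P.weylGroup)⁻¹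
    rw [map_mul, Equiv.Perm.mul_apply, ihg, ihh]
    group

/-- The product of the simple reflections of a word. -/
def weylWord (b : P.Base) (l : List b.support) : P.weylGroup :=
  (l.map fun i : b.support => weylReflection P i).prod

theorem weylWord_cons (b : P.Base) (i : b.support) (l : List b.support) :
    weylWord b (i :: l) = weylReflection P i * weylWord b l := by
  simp [weylWord]

theorem weylWord_append (b : P.Base) (l l' : List b.support) :
    weylWord b (l ++ l') = weylWord b l * weylWord b l' := by
  simp [weylWord]

theorem isPos_reflectionPerm_self_iff (b : P.Base) (i : ι) :
    b.IsPos (P.reflectionPerm i i) ↔ ¬ b.IsPos i :=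
  RootPairing.Base.IsPos.neg_iff_not b i

variable [Finite ι] [P.IsCrystallographic] [P.IsReduced]

/-- Every root is reached from simple ones by simple reflections and negation, and each such move
conjugates the corresponding reflection. -/
theorem exists_weylWord_eq (b : P.Base) (g : P.weylGroup) : ∃ l, weylWord b l = g := by
  have hmul : ∀ {g h : P.weylGroup}, (∃ l, weylWord b l = g) → (∃ l, weylWord b l = h) →
      ∃ l, weylWord b l = g * h := by
    rintro _ _ ⟨l, rfl⟩ ⟨l', rfl⟩
    exact ⟨l ++ l', weylWord_append b l l'⟩
  have hsimple : ∀ i ∈ b.support, ∃ l, weylWord b l = weylReflection P i := fun i hi =>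
    ⟨[⟨i, hi⟩], by simp [weylWord]⟩
  have hrefl : ∀ i, ∃ l, weylWord b l = weylReflection P i := by
    intro i
    refine b.induction_reflect i (p := fun i => ∃ l, weylWord b l = weylReflection P i)
      ?_ hsimple ?_
    · intro i h
      rw [weylReflection_reflectionPerm]
      exact hmul (hmul h h) h
    · intro i j h hj
      rw [weylReflection_reflectionPerm]
      exact hmul (hmul (hsimple j hj) h) (hsimple j hj)
  obtain ⟨g, hg⟩ := g
  induction hg using RootPairing.weylGroup.induction with
  | mem i => exact hrefl i
  | one => exact ⟨[], rfl⟩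
  | mul g h hg hh ihg ihh => exact hmul ihg ihh

/-- The exchange property: if a word sends a simple root `α_i` to a negative root, then multiplying
it by `s_i` gives an element with a shorter word. -/
theorem exists_weylWord_mul_eq (b : P.Base) (l : List b.support) (i : b.support)
    (h : ¬ b.IsPos (P.weylGroupToPerm (weylWord b l) i)) :
    ∃ l' : List b.support, l'.length < l.length ∧
      weylWord b l * weylReflection P i = weylWord b l' := by
  induction l with
  | nil => exact absurd (RootPairing.Base.isPos_of_mem_support i.2) h
  | cons j l ih =>
    by_cases hl : b.IsPos (P.weylGroupToPerm (weylWord b l) i)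
    · rw [weylWord_cons, map_mul, Equiv.Perm.mul_apply] at h
      change ¬ b.IsPos (P.reflectionPerm j _) at h
      -- The only positive root made negative by `s_j` is `α_j`. Hence the tail conjugates `s_i` to
      -- `s_j`, and multiplying by `s_i` on the right cancels the head of the word.
      have hj : P.weylGroupToPerm (weylWord b l) i = j := by
        by_contra hne
        exact h (RootPairing.Base.IsPos.reflectionPerm hl j.2 hne)
      refine ⟨l, by simp, ?_⟩
      have hc := weylReflection_weylGroupToPerm (weylWord b l) i
      rw [hj] at hc
      have hmul : weylWord b l * weylReflection P i = weylReflection P j * weylWord b l := by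
        rw [hc]; group
      rw [weylWord_cons, mul_assoc, hmul, ← mul_assoc, weylReflection_mul_self, one_mul]
    · obtain ⟨l', hl', he⟩ := ih hl
      exact ⟨j :: l', by simpa using hl', by rw [weylWord_cons, weylWord_cons, mul_assoc, he]⟩

/-- An element of the Weyl group that preserves the positive roots is trivial. -/
theorem eq_one_of_forall_isPos (b : P.Base) (g : P.weylGroup)
    (hg : ∀ i, b.IsPos i → b.IsPos (P.weylGroupToPerm g i)) : g = 1 := by
  obtain ⟨l, rfl⟩ := exists_weylWord_eq b g
  induction hn : l.length using Nat.strong_induction_on generalizing l with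
  | _ n ih =>
    subst hn
    rcases l.eq_nil_or_concat' with rfl | ⟨l, i, rfl⟩
    · rfl
    · have h1 : weylWord b (l ++ [i]) = weylWord b l * weylReflection P i := by
        simp [weylWord]
      -- With the last letter `s_i` removed, the word sends `α_i` to the negative of its image under
      -- the full word, and that image is positive. Exchange then yields a shorter word for the full
      -- product.
      have hneg : ¬ b.IsPos (P.weylGroupToPerm (weylWord b l) i) := by
        have h2 := hg _ (RootPairing.Base.isPos_of_mem_support i.2)
        have h3 : weylWord b l = weylWord b (l ++ [i]) * weylReflection P i := by
          rw [h1, mul_assoc, weylReflection_mul_self, mul_one]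
        have h4 : P.root (P.weylGroupToPerm (weylWord b l) i) =
            - P.root (P.weylGroupToPerm (weylWord b (l ++ [i])) i) := by
          rw [← P.weylGroup_apply_root, ← P.weylGroup_apply_root, h3, mul_smul]
          have : weylReflection P (i : ι) • P.root i = - P.root i := P.reflection_apply_self i
          rw [this, smul_neg]
        have h5 : P.weylGroupToPerm (weylWord b l) i =
            P.reflectionPerm (P.weylGroupToPerm (weylWord b (l ++ [i])) i)
              (P.weylGroupToPerm (weylWord b (l ++ [i])) i) := by
          apply P.root.injective
          rw [h4, P.root_reflectionPerm, P.reflection_apply_self]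
        rw [h5, isPos_reflectionPerm_self_iff]
        exact not_not.mpr h2
      obtain ⟨l', hl', he⟩ := exists_weylWord_mul_eq b l i hneg
      rw [← h1] at he
      rw [he]
      exact ih l'.length (by simp; lia) l' (by rwa [← he]) rfl

end Weyl

/-! ### Linear parts, translations, and their effect on Shi coefficients. -/

section Affine

variable {ι V N : Type u} [AddCommGroup V] [Module ℝ V] [AddCommGroup N] [Module ℝ N]
  {P : RootPairing ι ℝ V N}

theorem exists_eq_smul_add (w : V ≃ᵃ[ℝ] V) (hw : w ∈ affineWeylGroup P) :
    ∃ (g : P.weylGroup) (t : rootLattice P), ∀ x, w x = g • x + (t : V) := by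
  have gen : ∀ (j : ι) (k : ℤ), ∃ (g : P.weylGroup) (t : rootLattice P),
      ∀ x, affineReflection P j k x = g • x + (t : V) := fun j k =>
    ⟨weylReflection P j, k • latticeRoot P j, fun x => by
      rw [affineReflection_apply]
      change _ = P.reflection j x + k • P.root j
      rw [P.reflection_apply, ← Int.cast_smul_eq_zsmul ℝ]
      module⟩
  have inv : ∀ (j : ι) (k : ℤ), (affineReflection P j k)⁻¹ = affineReflection P j k := by
    intro j k
    rw [inv_eq_iff_mul_eq_one]
    ext x
    simp only [AffineEquiv.mul_def, AffineEquiv.trans_apply, affineReflection_apply, map_sub,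
      map_smul, P.root_coroot'_eq_pairing, P.pairing_same, smul_eq_mul]
    change _ = x
    module
  refine Subgroup.closure_induction'' (p := fun w _ => ∃ (g : P.weylGroup) (t : rootLattice P),
    ∀ x, w x = g • x + (t : V)) ?_ ?_ ?_ ?_ hw
  · rintro _ ⟨p, rfl⟩
    exact gen p.1 p.2
  · rintro _ ⟨p, rfl⟩
    simp only [inv]
    exact gen p.1 p.2
  · exact ⟨1, 0, fun x => by simp⟩
  · rintro v w _ _ ⟨g, t, hv⟩ ⟨h, s, hw⟩
    refine ⟨g * h, g • s + t, fun x => ?_⟩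
    rw [AffineEquiv.mul_def, AffineEquiv.trans_apply, hw, hv, smul_add, mul_smul, add_assoc]
    rfl

/-- Translation by a root is a product of two reflections in parallel hyperplanes, and these
translations generate those by `ℤΦ`. -/
theorem translation_mem_affineWeylGroup (x : rootLattice P) :
    translation (x : V) ∈ affineWeylGroup P := by
  have hzero : translation (0 : V) = 1 := AffineEquiv.constVAdd_zero ℝ V
  have hadd : ∀ x y : V, translation (x + y) = translation x * translation y := fun x y =>
    AffineEquiv.ext fun z => add_assoc x y z
  obtain ⟨x, hx⟩ := x
  change translation x ∈ _
  have hneg : ∀ x : V, translation (-x) = (translation x)⁻¹ := fun x => by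
    rw [eq_inv_iff_mul_eq_one, ← hadd, neg_add_cancel, hzero]
  have hx' : x ∈ AddSubgroup.closure (Set.range P.root) := by
    rwa [← Submodule.span_int_eq_addSubgroupClosure]
  clear hx
  induction hx' using AddSubgroup.closure_induction with
  | mem x h =>
    obtain ⟨i, rfl⟩ := h
    have : translation (P.root i) = affineReflection P i 1 * (affineReflection P i 0)⁻¹ := by
      rw [eq_mul_inv_iff_mul_eq]
      simp only [affineReflection, Int.cast_one, Int.cast_zero, one_smul, zero_smul, hzero, one_mul]
    rw [this]
    exact mul_mem (Subgroup.subset_closure ⟨(i, 1), rfl⟩)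
      (inv_mem (Subgroup.subset_closure ⟨(i, 0), rfl⟩))
  | zero => rw [hzero]; exact one_mem _
  | add x y _ _ hx hy =>
    rw [hadd]
    exact mul_mem hx hy
  | neg x _ hx =>
    rw [hneg]
    exact inv_mem hx

/-- Integrality of the Cartan numbers extends additively to the lattice. It makes translations shift
Shi coefficients by integers, and later turns strict real bounds into the values `0` and `1`. -/
theorem exists_int_coroot' [P.IsCrystallographic] (i : ι) (x : rootLattice P) :
    ∃ m : ℤ, P.coroot' i x = m := by
  obtain ⟨x, hx⟩ := x
  change ∃ m : ℤ, P.coroot' i x = m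
  induction hx using Submodule.span_induction with
  | mem x h =>
    obtain ⟨j, rfl⟩ := h
    obtain ⟨z, hz⟩ := P.exists_value (S := ℤ) j i
    exact ⟨z, by rw [P.root_coroot'_eq_pairing, ← hz]; simp⟩
  | zero => exact ⟨0, by simp⟩
  | add x y _ _ hx hy =>
    obtain ⟨m, hm⟩ := hx
    obtain ⟨n, hn⟩ := hy
    exact ⟨m + n, by rw [map_add, hm, hn]; push_cast; ring⟩
  | smul a x _ hx =>
    obtain ⟨m, hm⟩ := hx
    exact ⟨a * m, by rw [map_zsmul, hm, zsmul_eq_mul]; push_cast; ring⟩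

variable [Finite ι] [P.IsRootSystem] [P.IsCrystallographic]

/-- The element `τ_x w` of the affine Weyl group. -/
def translate (x : rootLattice P) (w : affineWeylGroup P) : affineWeylGroup P :=
  ⟨translation (x : V), translation_mem_affineWeylGroup x⟩ * w

theorem shiCoeff_translate (b : P.Base) (x : rootLattice P) (w : affineWeylGroup P)
    (α : PosRoot b) :
    (shiCoeff b (translate x w) α : ℝ) = shiCoeff b w α + P.coroot' α.1 x := by
  choose m hm using fun α : PosRoot b => exists_int_coroot' α.1 x
  have h : (fun α => shiCoeff b w α + m α) = shiCoeff b (translate x w) := by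
    -- By uniqueness of Shi coefficients, it suffices to see that the translated alcove is cut out
    -- by the shifted strips.
    refine (existsUnique_shi b (translate x w)).choose_spec.2 _ ?_
    have h1 : alcove b (translate x w) = (fun y => (x : V) + y) '' alcove b w := by
      rw [alcove, alcove, Set.image_image]
      rfl
    rw [h1, alcove_eq]
    ext y
    rw [Set.image_add_left]
    simp only [Set.mem_preimage, Set.mem_iInter, strip, Set.mem_ofPred_eq, map_add, map_neg, hm]
    push_cast
    refine forall_congr' fun α => and_congr ?_ ?_ <;> constructor <;> intro h <;> linarith
  rw [hm, ← h]
  push_cast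
  rfl

end Affine

/-! ### Freeness of the action on alcoves. -/

section Euclidean

variable {ι V N : Type u} [NormedAddCommGroup V] [InnerProductSpace ℝ V]
  [AddCommGroup N] [Module ℝ N] {P : RootPairing ι ℝ V N}

/-- A vector of the root lattice whose pairings with all coroots are at most `1` is zero: the root
lattice contains no nonzero minuscule vector. -/
theorem sum_root_eq_zero_of_coroot'_le_one
    (hP : ∀ (i : ι) (x : V),
      P.coroot' i x = 2 * inner ℝ x (P.root i) / inner ℝ (P.root i) (P.root i))
    (hint : ∀ (i : ι) (x : rootLattice P), ∃ m : ℤ, P.coroot' i x = m)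
    (l : List ι) (h : ∀ i, P.coroot' i (l.map P.root).sum ≤ 1) : (l.map P.root).sum = 0 := by
  classical
  induction hn : l.length generalizing l with
  | zero => simp [List.length_eq_zero_iff.mp hn]
  | succ n ih =>
    set t := (l.map P.root).sum with ht
    by_contra hne
    have hmem : t ∈ rootLattice P := by
      refine list_sum_mem fun x hx => ?_
      obtain ⟨i, -, rfl⟩ := List.mem_map.mp hx
      exact Submodule.subset_span ⟨i, rfl⟩
    -- Otherwise, summing over the list would give `⟨t, t⟩ ≤ 0`.
    have hex : ∃ i ∈ l, 0 < inner ℝ t (P.root i) := by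
      by_contra! hc
      have hsum : ∀ l' : List ι, (∀ i ∈ l', inner ℝ t (P.root i) ≤ 0) →
          inner ℝ t (l'.map P.root).sum ≤ 0 := by
        intro l' hl'
        induction l' with
        | nil => simp
        | cons i l' ih =>
          rw [List.map_cons, List.sum_cons, inner_add_right]
          have := hl' i (by simp)
          have := ih fun j hj => hl' j (by simp [hj])
          linarith
      have := hsum l hc
      rw [← ht] at this
      exact hne (inner_self_eq_zero.mp (le_antisymm this real_inner_self_nonneg))
    obtain ⟨i, hil, hi⟩ := hex
    have hpos : 0 < P.coroot' i t := by
      rw [hP]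
      have h0 : (0 : ℝ) < inner ℝ (P.root i) (P.root i) := by
        refine lt_of_le_of_ne real_inner_self_nonneg fun h0 => ?_
        rw [inner_self_eq_zero.mp h0.symm, inner_zero_right] at hi
        exact hi.false
      positivity
    have hone : P.coroot' i t = 1 := by
      obtain ⟨m, hm⟩ := hint i ⟨t, hmem⟩
      change P.coroot' i t = m at hm
      have h1 := h i
      rw [hm] at hpos h1 ⊢
      norm_cast at hpos h1 ⊢
      lia
    -- Since the pairing is exactly `1`, reflecting `t` subtracts one copy of the root, giving a sum
    -- with one term fewer. Reflections permute the coroots, so the bound persists and the induction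
    -- applies.
    have hrefl : ((l.erase i).map P.root).sum = P.reflection i t := by
      have := ((List.perm_cons_erase hil).map P.root).sum_eq
      rw [← ht, List.map_cons, List.sum_cons] at this
      rw [P.reflection_apply, hone, one_smul, this]
      abel
    have hz := ih (l.erase i) (fun j => by
      rw [hrefl, P.coroot'_reflection]
      exact h _) (by rw [List.length_erase_of_mem hil, hn]; rfl)
    rw [hrefl] at hz
    exact hne ((P.reflection i).map_eq_zero_iff.mp hz)

theorem exists_list_sum_root_eq (x : rootLattice P) : ∃ l : List ι, (l.map P.root).sum = x := by
  obtain ⟨x, hx⟩ := x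
  change ∃ l : List ι, (l.map P.root).sum = x
  rw [rootLattice, RootPairing.rootSpan, ← SetLike.mem_coe, ← Submodule.coe_toAddSubgroup,
    Submodule.span_int_eq_addSubgroupClosure, SetLike.mem_coe] at hx
  induction hx using AddSubgroup.closure_induction with
  | mem x h =>
    obtain ⟨i, rfl⟩ := h
    exact ⟨[i], by simp⟩
  | zero => exact ⟨[], by simp⟩
  | add x y _ _ hx hy =>
    obtain ⟨l, rfl⟩ := hx
    obtain ⟨l', rfl⟩ := hy
    exact ⟨l ++ l', by simp⟩
  | neg x h hx =>
    obtain ⟨l, rfl⟩ := hx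
    refine ⟨l.map fun i => P.reflectionPerm i i, ?_⟩
    clear h
    induction l with
    | nil => simp
    | cons i l ih =>
      rw [List.map_cons, List.map_cons, List.sum_cons, ih, P.root_reflectionPerm,
        P.reflection_apply_self, List.map_cons, List.sum_cons, neg_add]

variable [Finite ι] [P.IsRootSystem] [P.IsCrystallographic] [P.IsReduced]

/-- The stabilizer of the fundamental alcove in the affine Weyl group is trivial. -/
theorem eq_one_of_alcove_eq
    (hP : ∀ (i : ι) (x : V),
      P.coroot' i x = 2 * inner ℝ x (P.root i) / inner ℝ (P.root i) (P.root i))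
    (b : P.Base) (u : affineWeylGroup P)
    (hu : ∀ x ∈ fundAlcove b, (u : V ≃ᵃ[ℝ] V) x ∈ fundAlcove b) :
    u = 1 := by
  obtain ⟨g, t, hgt⟩ := exists_eq_smul_add (u : V ≃ᵃ[ℝ] V) u.2
  obtain ⟨x₀, hx₀⟩ := fundAlcove_nonempty b
  have hfund : ∀ {x}, x ∈ fundAlcove b ↔
      ∀ i, b.IsPos i → 0 < P.coroot' i x ∧ P.coroot' i x < 1 := by
    intro x
    simp [fundAlcove, strip]
  have hscale : ∀ ε : ℝ, 0 < ε → ε ≤ 1 → ε • x₀ ∈ fundAlcove b := by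
    intro ε h0 h1
    rw [hfund] at hx₀ ⊢
    intro i hi
    obtain ⟨h2, h3⟩ := hx₀ i hi
    rw [map_smul, smul_eq_mul]
    exact ⟨mul_pos h0 h2, lt_of_le_of_lt (mul_le_of_le_one_left h2.le h1) h3⟩
  have hbound : ∀ i, b.IsPos i → 0 ≤ P.coroot' i t ∧ P.coroot' i t ≤ 1 := by
    intro i hi
    set c := P.coroot' i (g • x₀)
    obtain ⟨m, hm⟩ := exists_int_coroot' i t
    -- The points `ε x₀` stay in the alcove while approaching the origin, which is sent to `t`.
    have hlim : ∀ ε : ℝ, 0 < ε → ε ≤ 1 →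
        0 < ε * c + P.coroot' i t ∧ ε * c + P.coroot' i t < 1 := by
      intro ε h0 h1
      have := hfund.mp (hu _ (hscale ε h0 h1)) i hi
      rwa [hgt, map_add, show g • ε • x₀ = ε • g • x₀ from
        map_smul (RootPairing.Equiv.weightEquiv P P g.1) ε x₀, map_smul, smul_eq_mul] at this
    have hcpos : 0 < |c| + 1 := by positivity
    -- No limit is needed: this `ε` gives `|ε c| < 1`, so the integer `⟨t, α^∨⟩` lies strictly
    -- between `-1` and `2`.
    obtain ⟨h1, h2⟩ := hlim (|c| + 1)⁻¹ (inv_pos.mpr hcpos)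
      (inv_le_one_of_one_le₀ (by linarith [abs_nonneg c]))
    have h3 : |(|c| + 1)⁻¹ * c| < 1 := by
      rw [abs_mul, abs_of_pos (inv_pos.mpr hcpos), inv_mul_lt_iff₀ hcpos]
      linarith
    rw [abs_lt] at h3
    rw [hm] at h1 h2 ⊢
    have h4 : (-1 : ℝ) < m := by linarith
    have h5 : (m : ℝ) < 2 := by linarith
    norm_cast at h4 h5 ⊢
    lia
  have ht : (t : V) = 0 := by
    obtain ⟨l, hl⟩ := exists_list_sum_root_eq t
    rw [← hl]
    refine sum_root_eq_zero_of_coroot'_le_one hP exists_int_coroot' l fun i => ?_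
    rw [hl]
    rcases pos_or_neg b i with hi | hi
    · exact (hbound i hi).2
    · have := (hbound _ hi).1
      rw [coroot'_neg] at this
      linarith
  have hcoroot : ∀ (h : P.weylGroup) (i : ι) (x : V),
      P.coroot' (P.weylGroupToPerm h i) (h • x) = P.coroot' i x := by
    rintro ⟨h, hh⟩
    induction hh using RootPairing.weylGroup.induction with
    | mem j =>
      intro i x
      change P.coroot' (P.reflectionPerm j i) (P.reflection j x) = _
      rw [← P.coroot'_reflection, P.reflection_same]
    | one =>
      intro i x
      change P.coroot' (P.weylGroupToPerm 1 i) ((1 : P.weylGroup) • x) = _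
      rw [map_one, one_smul]
      rfl
    | mul h k hh hk ihh ihk =>
      intro i x
      change P.coroot' (P.weylGroupToPerm (⟨h, hh⟩ * ⟨k, hk⟩) i)
        (((⟨h, hh⟩ * ⟨k, hk⟩ : P.weylGroup)) • x) = _
      rw [map_mul, mul_smul, Equiv.Perm.mul_apply, ihh, ihk]
  have hg : g = 1 := by
    refine eq_one_of_forall_isPos b g fun i hi => ?_
    -- If `g α` were negative, then `-g α` would be positive, yet its coroot takes the negative
    -- value `-⟨x₀, α^∨⟩` at `g x₀`, a point of the alcove.
    by_contra hneg
    rw [← isPos_reflectionPerm_self_iff] at hneg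
    have h1 := (hfund.mp (hu x₀ hx₀) _ hneg).1
    rw [hgt, ht, add_zero, coroot'_neg, hcoroot] at h1
    linarith [(hfund.mp hx₀ i hi).1]
  refine Subtype.ext (AffineEquiv.ext fun x => ?_)
  rw [hgt, ht, hg, one_smul, add_zero]
  rfl

/-- The coefficients determine the alcove, and `w'⁻¹ w` then preserves the fundamental one. -/
theorem eq_of_shiCoeff_eq
    (hP : ∀ (i : ι) (x : V),
      P.coroot' i x = 2 * inner ℝ x (P.root i) / inner ℝ (P.root i) (P.root i))
    (b : P.Base) {w w' : affineWeylGroup P} (h : shiCoeff b w = shiCoeff b w') : w = w' := by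
  have hA : alcove b w = alcove b w' := by rw [alcove_eq, alcove_eq, h]
  have : w'⁻¹ * w = 1 := by
    refine eq_one_of_alcove_eq hP b _ fun x hx => ?_
    have hx' : (w : V ≃ᵃ[ℝ] V) x ∈ alcove b w' := hA ▸ ⟨x, hx, rfl⟩
    obtain ⟨y, hy, hyx⟩ := hx'
    have : ((w'⁻¹ * w : affineWeylGroup P) : V ≃ᵃ[ℝ] V) x = y := by
      change (w' : V ≃ᵃ[ℝ] V).symm ((w : V ≃ᵃ[ℝ] V) x) = y
      rw [← hyx, AffineEquiv.symm_apply_apply]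
    rwa [this]
  exact (inv_mul_eq_one.mp this).symm

end Euclidean

/-! ### Cohomology classes in terms of simple Shi coefficients. -/

section Cohomology

open groupCohomology

variable {ι V N : Type u} [AddCommGroup V] [Module ℝ V] [AddCommGroup N] [Module ℝ N]
  {P : RootPairing ι ℝ V N}

theorem smul_sub_self_apply (x : rootLattice P) (i : ι) :
    ((weylReflection P i • x - x : rootLattice P) : V) = - (P.coroot' i x • P.root i) := by
  change P.reflection i (x : V) - x = _
  rw [P.reflection_apply]
  abel

variable [Finite ι] [P.IsCrystallographic] [P.IsReduced]

/-- The cocycle relation computes the value on a word from the values on its letters. -/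
theorem cocycle_eq_of_simple (b : P.Base) (c c' : cocycles₁ (latticeRep P))
    (h : ∀ i : b.support, c (weylReflection P i) = c' (weylReflection P i)) : c = c' := by
  refine cocycles₁_ext fun g => ?_
  obtain ⟨l, rfl⟩ := exists_weylWord_eq b g
  induction l with
  | nil => exact (cocycles₁_map_one c).trans (cocycles₁_map_one c').symm
  | cons i l ih =>
    have hmul : ∀ (c : cocycles₁ (latticeRep P)) (g g' : P.weylGroup),
        c (g * g') = (latticeRep P).ρ g (c g') + c g :=
      fun c => (mem_cocycles₁_iff c).mp c.2
    rw [weylWord_cons, hmul, hmul, ih, h]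

variable [P.IsRootSystem]

theorem sectionCocycle_shiSection_apply (b : P.Base) (w : affineWeylGroup P) (i : b.support) :
    sectionCocycle P (shiSection b w) (weylReflection P i) =
      (shiCoeff b w (simplePos b i) • latticeRoot P i : rootLattice P) := by
  change ((shiSection b w (weylReflection P i)).left.toAdd : rootLattice P) = _
  rw [shiSection_apply]
  simp [semi]

/-- The sections attached to `w` and `w'` have the same cohomology class if and only if the Shi
coefficients of `w` and `w'` at the simple roots differ by those of a translation. -/
theorem sectionClass_eq_iff (b : P.Base) (w w' : affineWeylGroup P) :
    sectionClass P (shiSection b w) = sectionClass P (shiSection b w') ↔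
      ∃ x : rootLattice P, ∀ i : b.support, (shiCoeff b w' (simplePos b i) : ℝ) =
        shiCoeff b w (simplePos b i) + P.coroot' i x := by
  -- At `s_i` both the coboundary of `x` and the difference of cocycles are multiples of the nonzero
  -- vector `α_i`, so only the scalars need comparing.
  have key : ∀ (x : rootLattice P) (i : b.support),
      (weylReflection P i • x - x : rootLattice P) =
          shiCoeff b w (simplePos b i) • latticeRoot P i -
            shiCoeff b w' (simplePos b i) • latticeRoot P i ↔
        (shiCoeff b w' (simplePos b i) : ℝ) =
          shiCoeff b w (simplePos b i) + P.coroot' i x := by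
    intro x i
    rw [← sub_smul, Subtype.ext_iff, smul_sub_self_apply]
    change _ = (shiCoeff b w (simplePos b i) - shiCoeff b w' (simplePos b i)) • P.root i ↔ _
    rw [← Int.cast_smul_eq_zsmul ℝ, ← neg_smul, smul_left_injective ℝ (P.ne_zero i) |>.eq_iff]
    push_cast
    constructor <;> intro h <;> linarith
  rw [sectionClass, sectionClass, H1π_eq_iff]
  constructor
  · rintro ⟨x, hx⟩
    refine ⟨x, fun i => (key x i).mp ?_⟩
    have := congrFun hx (weylReflection P i)
    rw [Pi.sub_apply, sectionCocycle_shiSection_apply, sectionCocycle_shiSection_apply] at this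
    exact this
  · rintro ⟨x, hx⟩
    let d : cocycles₁ (latticeRep P) :=
      coboundariesToCocycles₁ (latticeRep P) ⟨_, LinearMap.mem_range_self _ x⟩
    have : d = sectionCocycle P (shiSection b w) - sectionCocycle P (shiSection b w') := by
      refine cocycle_eq_of_simple b _ _ fun i => ?_
      have h1 : (sectionCocycle P (shiSection b w) - sectionCocycle P (shiSection b w'))
          (weylReflection P i) = sectionCocycle P (shiSection b w) (weylReflection P i) -
            sectionCocycle P (shiSection b w') (weylReflection P i) := rfl
      rw [h1, sectionCocycle_shiSection_apply, sectionCocycle_shiSection_apply]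
      exact (key x i).mpr (hx i)
    exact ⟨x, congrArg Subtype.val this⟩

end Cohomology

/-! ### Affine equations of `X[λ]` and irreducible components. -/

section Components

variable {ι V N : Type u} [NormedAddCommGroup V] [InnerProductSpace ℝ V]
  [AddCommGroup N] [Module ℝ N] {P : RootPairing ι ℝ V N}

theorem coroot'_eq_sum (b : P.Base) (θ : PosRoot b) (x : V) :
    P.coroot' θ.1 x = ∑ i : b.support, (corootCoeff b θ i : ℝ) * P.coroot' i x := by
  have h := b.flip.toWeightBasisInt.sum_repr (P.flip.rootSpanMem ℤ θ.1)
  have h' : ∑ i : b.support, corootCoeff b θ i • P.coroot i = P.coroot θ.1 := by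
    have := congrArg (Subtype.val) h
    rw [Submodule.coe_sum] at this
    refine Eq.trans (Finset.sum_congr rfl fun i _ => ?_) this
    have hi : (b.flip.toWeightBasisInt i : N) = P.coroot i :=
      b.flip.coe_toWeightBasisInt_apply i
    exact congrArg (corootCoeff b θ i • ·) hi.symm
  change P.toLinearMap x (P.coroot θ.1) = _
  rw [← h', map_sum]
  refine Finset.sum_congr rfl fun i _ => ?_
  rw [map_zsmul, zsmul_eq_mul]
  rfl

/-- The linear part has the same coefficients as in `coroot'_eq_sum`; this match is what lets a
translation be recognized from simple coordinates alone. -/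
theorem mem_component_iff (b : P.Base) (l : PosRoot b → ℕ) (x : PosRoot b → ℝ) :
    x ∈ component b l ↔
      ∀ θ, x θ = ∑ i : b.support, (corootCoeff b θ i : ℝ) * x (simplePos b i) + l θ := by
  rw [component, MvPolynomial.zeroLocus_span]
  simp only [Set.forall_mem_range, Set.mem_ofPred_eq, linPoly, map_sub, map_add, map_sum, map_mul,
    MvPolynomial.aeval_X, MvPolynomial.aeval_C, Algebra.algebraMap_self, RingHom.id_apply]
  exact forall_congr' fun θ => by rw [sub_eq_zero, eq_comm]

theorem finite_isAdmitted [Finite ι] (b : P.Base) : {l | IsAdmitted b l}.Finite := by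
  refine (Set.Finite.pi' (t := fun α : PosRoot b => Set.Iic (corootHeight b α - 1).toNat)
    fun α => Set.finite_Iic _).subset fun l hl α => ?_
  have := hl.1 α
  simp only [Set.mem_Iic]
  lia

/-- An irreducible component of the Shi variety is contained in one of the `X[λ]`. -/
theorem IsIrredComponent.exists_subset_component [Finite ι] {b : P.Base} {Z : Set (PosRoot b → ℝ)}
    (hZ : IsIrredComponent (shiVariety b) Z) : ∃ l, Z ⊆ component b l := by
  classical
  obtain ⟨hsub, hirr⟩ := hZ.prop
  let := zariskiTopology (PosRoot b)
  obtain ⟨C, hC, hZC⟩ := isIrreducible_iff_sUnion_isClosed.mp hirr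
    ((finite_isAdmitted b).toFinset.image (component b)) (fun C hC => by
      obtain ⟨l, -, rfl⟩ := Finset.mem_image.mp hC
      -- Open sets are the complements of zero loci, so closedness asks for the double complement to
      -- be a zero locus.
      exact ⟨⟨_, (compl_compl _).symm⟩⟩) (fun x hx => by
      obtain ⟨l, hl, hxl⟩ := Set.mem_iUnion₂.mp (hsub hx)
      exact ⟨_, Finset.mem_coe.mpr (Finset.mem_image_of_mem _
        ((finite_isAdmitted b).mem_toFinset.mpr hl)), hxl⟩)
  obtain ⟨l, -, rfl⟩ := Finset.mem_image.mp hC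
  exact ⟨l, hZC⟩

end Components

end ShiVariety

end

/-- `P` is an irreducible reduced crystallographic root system in the Euclidean space `V` (`hP` says
that the dual root of `α` is `α^∨ = 2α / ⟨α, α⟩`), `b` is a simple system, and `w`, `w'` are
elements of the affine Weyl group. -/
theorem mainTheorem1 {ι V N : Type u} [Finite ι]
    [NormedAddCommGroup V] [InnerProductSpace ℝ V] [AddCommGroup N] [Module ℝ N]
    (P : RootPairing ι ℝ V N) [P.IsRootSystem] [P.IsCrystallographic] [P.IsReduced]
    [P.IsIrreducible]
    (hP : ∀ (i : ι) (x : V),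
      P.coroot' i x = 2 * inner ℝ x (P.root i) / inner ℝ (P.root i) (P.root i))
    (b : P.Base) (w w' : ShiVariety.affineWeylGroup P)
    (hcomp : ShiVariety.SameComponent b w w') :
    ShiVariety.SameOrientation w w' ↔
      ShiVariety.sectionClass P (ShiVariety.shiSection b w) =
        ShiVariety.sectionClass P (ShiVariety.shiSection b w') := by
  open ShiVariety in
  rw [sectionClass_eq_iff]
  constructor
  · rintro ⟨x, hx⟩
    refine ⟨x, fun i => ?_⟩
    rw [show w' = translate x w from Subtype.ext hx, shiCoeff_translate]
    rfl
  · rintro ⟨x, hx⟩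
    obtain ⟨Z, hZ, hw, hw'⟩ := hcomp
    obtain ⟨l, hl⟩ := hZ.exists_subset_component
    have h := (mem_component_iff b l _).mp (hl hw)
    have h' := (mem_component_iff b l _).mp (hl hw')
    -- Both Shi vectors satisfy the equations of the same `X[λ]`, so `λ_θ` cancels and the
    -- difference at `θ` is the combination of the `⟨x, α_i^∨⟩` that equals `⟨x, θ^∨⟩`.
    have : w' = translate x w := by
      refine eq_of_shiCoeff_eq hP b (funext fun θ => ?_)
      have e := h θ
      have e' := h' θ
      simp only [shiVector] at e e'
      rw [← Int.cast_inj (α := ℝ), shiCoeff_translate, e, e', coroot'_eq_sum]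
      simp only [hx, mul_add, Finset.sum_add_distrib]
      ring
    exact ⟨x, congrArg Subtype.val this⟩
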